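/- Let $\Phi\colon 2^\omega\to\omega^\omega$ be a partial computable functional with a computable stage-by-stage approximation $\Phi(Z;n)[s]$ that uses only the first $s$ bits of $Z$ (a value, once found, is kept at later stages) and satisfies the usual conventions: if $\Phi(Z;n)\downarrow[s]$, then $\Phi(Z;n)[s]\le s$ and $\Phi(Z;m)\downarrow[s]$ for all $m<n$. Let $B\subseteq\omega$, let $\mu$ be Lebesgue (fair-coin) measure on $2^\omega$, and put $$\operatorname{dom}_B=\{Z:\Phi(B\oplus Z)\text{ is total}\},\qquad D_{[a,|g|)}[g]=\{Z:(\forall k\in[a,|g|))\ \Phi(B\oplus Z;k)\downarrow[g(k)]\}\quad(g\in\omega^{<\omega}).$$ The forcing $\mathbb{P}_B$ consists of the conditions $\mathbf p=\langle f^{\mathbf p},\varepsilon^{\mathbf p}\rangle$ with $f^{\mathbf p}\in\omega^{<\omega}$ and $\varepsilon^{\mathbf p}$ a positive rational; $\mathbf q\le\mathbf p$ ($\mathbf q$ extends $\mathbf p$) means that $f^{\mathbf p}$ is an initial segment of $f^{\mathbf q}$, $\varepsilon^{\mathbf q}\le\varepsilon^{\mathbf p}$, and, if $f^{\mathbf p}\neq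 f^{\mathbf q}$, then $\mu\big(\operatorname{dom}_B\setminus D_{[|f^{\mathbf p}|,|f^{\mathbf q}|)}[f^{\mathbf q}]\big)+\varepsilon^{\mathbf q}<\varepsilon^{\mathbf p}$. A statement holds for every generic $G\subset\mathbb{P}_B$ if there is a countable family of dense subsets of $\mathbb{P}_B$ such that it holds for every filter $G$ that meets all members of the family; for such $G$, $f^G=\bigcup_{\mathbf p\in G}f^{\mathbf p}$. An oracle $X$ is of DNR degree if it computes a function $h\colon\omega\to\omega$ with $h(e)\ne\varphi_e(e)$ whenever $\varphi_e(e)\downarrow$, where $\langle\varphi_e\rangle$ is a standard enumeration of the partial computable functions; it is of PA degree if every partial computable $\{0,1\}$-valued function has a total $\{0,1\}$-valued extension computable from $X$. Then the following hold. 1. For every $\mathbf p\in\mathbb{P}_B$ there are a set $S$, c.e. in $B$, with $S\subseteq\{f^{\mathbf q}:\mathbf q\le\mathbf p\}$, and a condition $\mathbf p^*\le\mathbf p$ such that $\{\mathbf q\le\mathbf p^*: f^{\mathbf q}\in S\}$ is dense below $\mathbf p^*$. 2. If $B$ is not of DNR degree and $G\subset\mathbb{P}_B$ is generic, then $f^G$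 is a total function and $B\oplus f^G$ is not of DNR degree. 3. If $B$ is not of PA degree and $G\subset\mathbb{P}_B$ is generic, then $f^G$ is a total function and $B\oplus f^G$ is not of PA degree. -/

import Mathlib

open MeasureTheory

namespace AEDomination

noncomputable section

/-! ### Oracles, joins, reducibility -/

/-- A total function as an oracle. -/
def oracle (X : ℕ → ℕ) : Set (ℕ →. ℕ) := {fun n => Part.some (X n)}

/-- The function `ℕ → ℕ` coding a set of natural numbers (given as a point of Cantor space). -/
def charFn (B : ℕ → Bool) : ℕ → ℕ := fun n => (B n).toNat

/-- The join `X ⊕ Y`: `X` on the even numbers and `Y` on the odd numbers. -/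
def join {α : Type} (X Y : ℕ → α) : ℕ → α :=
  fun n => if n % 2 = 0 then X (n / 2) else Y (n / 2)

/-- A set of strings is c.e. in `B`: it is the domain of a function partial recursive in `B`. -/
def CEIn (B : ℕ → Bool) (S : Set (List ℕ)) : Prop :=
  RecursiveIn (oracle (charFn B)) fun g : List ℕ => Part.assert (g ∈ S) fun _ => Part.some ()

/-! ### DNR degrees and PA degrees -/

/-- `h` is diagonally non-recursive: `h e ≠ φ_e(e)` whenever `φ_e(e)` converges, where `φ_e` is the
`e`-th partial computable function. -/
def IsDNR (h : ℕ → ℕ) : Prop :=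
  ∀ e : ℕ, h e ∉ Nat.Partrec.Code.eval (Denumerable.ofNat Nat.Partrec.Code e) e

/-- The oracle `X` is of DNR degree: it computes a DNR function. -/
def HasDNRDegree (X : ℕ → ℕ) : Prop :=
  ∃ h : ℕ → ℕ, IsDNR h ∧ ComputableIn (oracle X) h

/-- The oracle `X` is of PA degree: every partial computable `{0,1}`-valued function has a total
`{0,1}`-valued extension computable in `X`. -/
def HasPADegree (X : ℕ → ℕ) : Prop :=
  ∀ ψ : ℕ →. Bool, Partrec ψ →
    ∃ h : ℕ → Bool, (∀ n, ∀ v ∈ ψ n, h n = v) ∧ ComputableIn (oracle X) h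

/-! ### Partial computable functionals -/

/-- A partial computable functional `Φ` from Cantor space to Baire space, given by its computable
approximation on finite oracle strings: `approx σ n` is the value (if any) that is computed within
`σ.length` steps from the part `σ` of the oracle. -/
structure Functional where
  approx : List Bool → ℕ → Option ℕ
  computable : Computable₂ approx
  mono : ∀ (σ τ : List Bool) (n m : ℕ), σ <+: τ → approx σ n = some m → approx τ n = some m

/-- `Φ(Z; n)[s]`, the result (if any) of the computation after `s` steps. -/
def Functional.stage (Φ : Functional) (Z : ℕ → Bool) (n s : ℕ) : Option ℕ :=
  Φ.approx ((List.range s).map Z) n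

/-- The standard conventions on stages: a value that is found by stage `s` is at most `s`, and
`Φ(Z; n)` does not converge by stage `s` unless all `Φ(Z; m)`, `m < n`, do. -/
def Functional.Standard (Φ : Functional) : Prop :=
  ∀ (Z : ℕ → Bool) (n s v : ℕ), Φ.stage Z n s = some v →
    v ≤ s ∧ ∀ m < n, (Φ.stage Z m s).isSome

/-! ### The notion of forcing -/

/-- The fair-coin (Lebesgue) measure on Cantor space. -/
def cantorMeasure : Measure (ℕ → Bool) :=
  Measure.infinitePi fun _ : ℕ => (PMF.uniformOfFintype Bool).toMeasure

instance : IsProbabilityMeasure cantorMeasure := by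
  unfold cantorMeasure; infer_instance

/-- The set of all `Z` such that `Φ(B ⊕ Z)` is total. -/
def dom (Φ : Functional) (B : ℕ → Bool) : Set (ℕ → Bool) :=
  {Z | ∀ n, ∃ s, (Φ.stage (join B Z) n s).isSome}

/-- `D_{[a, |g|)}[g]`: the set of all `Z` such that `Φ(B ⊕ Z; k)` converges by stage `g(k)` for all
`k` with `a ≤ k < |g|`. -/
def bounded (Φ : Functional) (B : ℕ → Bool) (a : ℕ) (g : List ℕ) : Set (ℕ → Bool) :=
  {Z | ∀ (k : ℕ) (hk : k < g.length), a ≤ k → (Φ.stage (join B Z) k g[k]).isSome}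

/-- A condition: a finite string of natural numbers together with a positive rational. -/
structure Condition (Φ : Functional) (B : ℕ → Bool) where
  str : List ℕ
  eps : ℚ
  eps_pos : 0 < eps

/-- `q` extends `p`. -/
def Condition.Extends {Φ : Functional} {B : ℕ → Bool} (q p : Condition Φ B) : Prop :=
  p.str <+: q.str ∧ q.eps ≤ p.eps ∧
    (p.str ≠ q.str →
      cantorMeasure.real (dom Φ B \ bounded Φ B p.str.length q.str) + (q.eps : ℝ) < (p.eps : ℝ))

theorem Condition.Extends.trans {Φ : Functional} {B : ℕ → Bool} {r q p : Condition Φ B}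
    (h : r.Extends q) (h' : q.Extends p) : r.Extends p := by
  obtain ⟨h1, h2, h3⟩ := h
  obtain ⟨h1', h2', h3'⟩ := h'
  have e2 : (r.eps : ℝ) ≤ q.eps := by exact_mod_cast h2
  have e2' : (q.eps : ℝ) ≤ p.eps := by exact_mod_cast h2'
  refine ⟨h1'.trans h1, h2.trans h2', fun hne => ?_⟩
  by_cases hpq : p.str = q.str
  · have := h3 (hpq ▸ hne)
    rw [← hpq] at this
    linarith
  by_cases hqr : q.str = r.str
  · have := h3' hpq
    rw [hqr] at this
    linarith
  have a := h3 hqr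
  have b := h3' hpq
  have sub : dom Φ B \ bounded Φ B p.str.length r.str ⊆
      (dom Φ B \ bounded Φ B p.str.length q.str) ∪
        (dom Φ B \ bounded Φ B q.str.length r.str) := by
    rintro Z ⟨hZ, hn⟩
    by_contra hc
    simp only [Set.mem_union, Set.mem_sdiff, hZ, true_and, not_or, not_not] at hc
    refine hn fun k hk hpk => ?_
    by_cases hkq : k < q.str.length
    · have := hc.1 k hkq hpk
      rwa [h1.getElem hkq] at this
    · exact hc.2 k hk (not_lt.1 hkq)
  have := (measureReal_mono (μ := cantorMeasure) sub).trans (measureReal_union_le _ _)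
  linarith

/-- The notion of forcing `ℙ_B`, ordered by extension. -/
instance (Φ : Functional) (B : ℕ → Bool) : Preorder (Condition Φ B) where
  le := Condition.Extends
  le_refl _ := ⟨List.prefix_rfl, le_rfl, fun h => absurd rfl h⟩
  le_trans _ _ _ h h' := h.trans h'

/-- `D` is dense below `p`. -/
def DenseBelow {P : Type} [Preorder P] (p : P) (D : Set P) : Prop :=
  ∀ q ≤ p, ∃ r ≤ q, r ∈ D

/-- `D` is dense. -/
def IsDense {P : Type} [Preorder P] (D : Set P) : Prop :=
  ∀ p, ∃ q ≤ p, q ∈ D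

/-- `Q` holds of every sufficiently generic filter: there are countably many dense sets such that
`Q` holds of every filter that meets all of them. -/
def ForSufficientlyGeneric {P : Type} [Preorder P] (Q : Order.PFilter P → Prop) : Prop :=
  ∃ 𝒟 : Set (Set P), 𝒟.Countable ∧ (∀ D ∈ 𝒟, IsDense D) ∧
    ∀ G : Order.PFilter P, (∀ D ∈ 𝒟, ∃ p ∈ G, p ∈ D) → Q G

/-- `f` is the function `f^G`, that is, `f` is total and its graph is the union of the strings of
the conditions in `G`. -/
def IsGenericFunction {Φ : Functional} {B : ℕ → Bool} (G : Order.PFilter (Condition Φ B))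
    (f : ℕ → ℕ) : Prop :=
  ∀ n m : ℕ, f n = m ↔ ∃ p ∈ G, p.str[n]? = some m

end

end AEDomination

open AEDomination

/-!
Let `p = ⟨f, ε⟩`. Since `D_{[|f|, |g|)}[g]` depends on finitely many bits of `B` and `Z`, the
strings `g` for which its measure is at least a given rational are c.e. in `B`; take a rational
between `μ(dom) - 3 * ε / 4` and `μ(dom) - ε / 2`. The standard conventions make the sets where
`Φ(B ⊕ Z; n)` converges decrease to `dom`, so when `g` is long, `D_{[|f|, |g|)}[g]` exceeds `dom` by
less than `ε / 4`; it then misses less than `ε` of `dom`, and `g` belongs to an extension of `p`.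
Conversely, long strings of extensions of `⟨f, ε / 2⟩` are of this kind.

Being of DNR or PA degree means being able to choose an element from each set of certain families
`A n`. Let `T` be an oracle functional and let `S` be the c.e. set of strings below a condition. If
`T` with oracle `B ⊕ g` takes a value outside some `A n` for some `g ∈ S`, a condition with string
`g` prevents `T` from choosing. Otherwise all values found along `S` are good, so if `T` converged
densely at each argument, `B` itself could search `S` and choose. There are only countably many `T`.
-/

namespace AEDomination

open Encodable Filter

/-! ### Initial segments -/

section InitSeg

variable {α : Type*}

theorem getElem?_eq_some_of_prefix {l l' : List α} {i : ℕ} {x : α} (hl : l <+: l')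
    (h : l[i]? = some x) : l'[i]? = some x := by
  obtain ⟨hi, rfl⟩ := List.getElem?_eq_some_iff.1 h
  exact List.prefix_iff_getElem?.1 hl i hi

/-- The initial segment `X ↾ s` of length `s` of a sequence `X`. -/
def initSeg (X : ℕ → α) (s : ℕ) : List α := (List.range s).map X

@[simp] theorem length_initSeg (X : ℕ → α) (s : ℕ) : (initSeg X s).length = s := by
  simp [initSeg]

theorem initSeg_succ (X : ℕ → α) (s : ℕ) : initSeg X (s + 1) = initSeg X s ++ [X s] := by
  simp [initSeg, List.range_succ]

theorem take_initSeg (X : ℕ → α) (s t : ℕ) : (initSeg X t).take s = initSeg X (min s t) := by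
  simp [initSeg, ← List.map_take, List.take_range]

theorem initSeg_prefix (X : ℕ → α) {s t : ℕ} (h : s ≤ t) : initSeg X s <+: initSeg X t := by
  rw [← min_eq_left h, ← take_initSeg]
  exact List.take_prefix _ _

theorem getElem?_initSeg (X : ℕ → α) {s i : ℕ} (h : i < s) : (initSeg X s)[i]? = some (X i) := by
  simp [initSeg, h]

theorem getD_initSeg (X : ℕ → α) {s i : ℕ} (h : i < s) (d : α) :
    (initSeg X s).getD i d = X i := by
  rw [List.getD_eq_getElem?_getD, getElem?_initSeg X h, Option.getD_some]

theorem initSeg_congr {X Y : ℕ → α} {s : ℕ} (h : ∀ i < s, X i = Y i) :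
    initSeg X s = initSeg Y s :=
  List.map_congr_left fun i hi => h i (List.mem_range.1 hi)

end InitSeg

/-! ### Effective operators on partial functions -/

/-- Every value of the partial function `f` is eventually, along `l`, a value of `F s`. With `l` a
point mass this says that `F s` extends `f`, and for a sequence it says that `f` is at most the
limit inferior of the `F s`; the same closure properties hold in both cases. -/
def EventuallyExtends {ι : Type} (l : Filter ι) (F : ι → ℕ →. ℕ) (f : ℕ →. ℕ) : Prop :=
  ∀ n, ∀ v ∈ f n, ∀ᶠ s in l, v ∈ F s n

/-- An effective operator on pairs of partial functions: it preserves partial computability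
uniformly in a parameter, and it is continuous in the sense that each value of `K f g` depends on
finitely many values of `f` and `g`. -/
structure IsEffectiveOperator (K : (ℕ →. ℕ) → (ℕ →. ℕ) → ℕ →. ℕ) : Prop where
  partrec {T U : List ℕ → ℕ →. ℕ} : Partrec₂ T → Partrec₂ U → Partrec₂ fun σ => K (T σ) (U σ)
  eventuallyExtends {ι : Type} {l : Filter ι} {F G : ι → ℕ →. ℕ} {f g : ℕ →. ℕ} :
    EventuallyExtends l F f → EventuallyExtends l G g →
      EventuallyExtends l (fun s => K (F s) (G s)) (K f g)

theorem mem_pair_seq_iff {f g : Part ℕ} {v : ℕ} :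
    v ∈ Nat.pair <$> f <*> g ↔ ∃ a ∈ f, ∃ b ∈ g, Nat.pair a b = v := by
  simp only [Seq.seq, Part.map_eq_map, Part.mem_bind_iff, Part.mem_map_iff,
    exists_exists_and_eq_and]

theorem isEffectiveOperator_pair :
    IsEffectiveOperator fun f g n => Nat.pair <$> f n <*> g n where
  partrec {T U} hT hU := by
    have hmap : Partrec₂ fun (p : List ℕ × ℕ) (a : ℕ) => (U p.1 p.2).map (Nat.pair a) :=
      (hU.comp₂ (Computable.fst.comp Computable.fst).to₂
        (Computable.snd.comp Computable.fst).to₂).map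
        (Primrec₂.natPair.to_comp.comp (Computable.snd.comp Computable.fst) Computable.snd).to₂
    refine (Partrec.bind hT hmap).of_eq fun p => Part.ext fun v => ?_
    rw [mem_pair_seq_iff]
    simp only [Part.mem_bind_iff, Part.mem_map_iff]
  eventuallyExtends hf hg n v hv := by
    obtain ⟨a, ha, b, hb, rfl⟩ := mem_pair_seq_iff.1 hv
    filter_upwards [hf n a ha, hg n b hb] with s hs ht
    exact mem_pair_seq_iff.2 ⟨a, hs, b, ht, rfl⟩

theorem isEffectiveOperator_comp : IsEffectiveOperator fun f g n => g n >>= f where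
  partrec hT hU := Partrec.bind hU
    (Partrec₂.comp hT (Computable.fst.comp Computable.fst) Computable.snd)
  eventuallyExtends hf hg n v hv := by
    obtain ⟨a, ha, hb⟩ := Part.mem_bind_iff.1 hv
    filter_upwards [hf a v hb, hg n a ha] with s hs ht using Part.mem_bind ht hs

theorem isEffectiveOperator_prec : IsEffectiveOperator fun f g p =>
    let (a, n) := Nat.unpair p
    n.rec (f a) fun y IH => do
      let i ← IH
      g (Nat.pair a (Nat.pair y i)) where
  partrec {T U} hT hU := by
    have ha : Computable fun p : List ℕ × ℕ => p.2.unpair.1 :=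
      Computable.fst.comp (Computable.unpair.comp Computable.snd)
    refine Partrec.nat_rec (Computable.snd.comp (Computable.unpair.comp Computable.snd))
      (hT.comp Computable.fst ha) (h := fun p q => U p.1 (Nat.pair p.2.unpair.1 (Nat.pair q.1 q.2)))
      (hU.comp (Computable.fst.comp Computable.fst) ?_)
    exact Primrec₂.natPair.to_comp.comp (ha.comp Computable.fst)
      (Primrec₂.natPair.to_comp.comp (Computable.fst.comp Computable.snd)
        (Computable.snd.comp Computable.snd))
  eventuallyExtends hf hg p v hv := by
    dsimp only at hv ⊢
    generalize p.unpair.2 = n at hv ⊢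
    induction n generalizing v with
    | zero => exact hf _ v hv
    | succ n ih =>
      obtain ⟨i, hi, hv⟩ := Part.mem_bind_iff.1 hv
      filter_upwards [ih i hi, hg _ v hv] with s hs ht using Part.mem_bind hs ht

theorem mem_rfind_eq_zero_iff {f : ℕ →. ℕ} {v : ℕ} :
    (v ∈ Nat.rfind fun n => (fun m => decide (m = 0)) <$> f n) ↔
      0 ∈ f v ∧ ∀ j < v, ∃ m ∈ f j, m ≠ 0 :=
  Nat.mem_rfind.trans (by simp)

theorem isEffectiveOperator_rfind : IsEffectiveOperator fun f _ a =>
    Nat.rfind fun n => (fun m => decide (m = 0)) <$> f (Nat.pair a n) where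
  partrec {T _} hT _ := by
    refine Partrec.rfind (p := fun (p : List ℕ × ℕ) n =>
      (T p.1 (Nat.pair p.2 n)).map fun m => decide (m = 0)) (Partrec.map ?_ ?_)
    · exact hT.comp (Computable.fst.comp Computable.fst)
        (Primrec₂.natPair.to_comp.comp (Computable.snd.comp Computable.fst) Computable.snd)
    · exact (Primrec.eq.decide.to_comp.comp Computable.snd (Computable.const 0)).to₂
  eventuallyExtends {_ l F _ f _} hf _ a v hv := by
    obtain ⟨h0, hne⟩ := mem_rfind_eq_zero_iff.1 hv
    have hne : ∀ᶠ s in l, ∀ j < v, ∃ m ∈ F s (Nat.pair a j), m ≠ 0 :=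
      (eventually_all_finite (Set.finite_lt_nat v)).2 fun j hj => by
        obtain ⟨m, hm, hm0⟩ := hne j hj
        exact (hf _ m hm).mono fun s hs => ⟨m, hs, hm0⟩
    filter_upwards [hf _ 0 h0, hne] with s hs ht using mem_rfind_eq_zero_iff.2 ⟨hs, ht⟩

/-! ### Oracle computations on finite parts of the oracle -/

/-- An oracle Turing functional, as a uniformly partial recursive family of partial functions
indexed by finite parts of the oracle: `T.run σ n` is the result on input `n` of the computation
that queries the oracle only inside `σ` (and diverges if it asks for more). -/
structure TuringFunctional where
  run : List ℕ → ℕ →. ℕ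
  partrec : Partrec₂ run
  mono {σ τ : List ℕ} {n v : ℕ} : σ <+: τ → v ∈ run σ n → v ∈ run τ n

namespace TuringFunctional

/-- `f` is the partial function that `T` computes from the oracle `X`. -/
def Computes (T : TuringFunctional) (X : ℕ → ℕ) (f : ℕ →. ℕ) : Prop :=
  ∀ n v, v ∈ f n ↔ ∃ s, v ∈ T.run (initSeg X s) n

variable {T U : TuringFunctional} {X : ℕ → ℕ} {f g : ℕ →. ℕ}

theorem mono_dom {σ τ : List ℕ} {n : ℕ} (hp : σ <+: τ) (h : (T.run σ n).Dom) :
    (T.run τ n).Dom :=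
  Part.dom_iff_mem.2 ((Part.dom_iff_mem.1 h).imp fun _ => T.mono hp)

theorem Computes.dom_iff (h : T.Computes X f) (n : ℕ) :
    (f n).Dom ↔ ∃ s, (T.run (initSeg X s) n).Dom := by
  simp only [Part.dom_iff_mem, h n]
  exact exists_comm

theorem computes_iff_eventuallyExtends : T.Computes X f ↔
    (∀ s, EventuallyExtends (pure ()) (fun _ => f) (T.run (initSeg X s))) ∧
      EventuallyExtends atTop (fun s => T.run (initSeg X s)) f := by
  simp only [EventuallyExtends, eventually_pure]
  refine ⟨fun h => ⟨fun s n v hv => (h n v).2 ⟨s, hv⟩, fun n v hv => ?_⟩,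
    fun h n v => ⟨fun hv => (h.2 n v hv).exists, fun ⟨s, hv⟩ => h.1 s n v hv⟩⟩
  obtain ⟨s, hs⟩ := (h n v).1 hv
  filter_upwards [eventually_ge_atTop s] with t ht using T.mono (initSeg_prefix X ht) hs

theorem exists_computes_of_computable {f : ℕ → ℕ} (hf : Computable f) (X : ℕ → ℕ) :
    ∃ T : TuringFunctional, T.Computes X fun n => Part.some (f n) :=
  ⟨⟨fun _ n => Part.some (f n), (hf.comp Computable.snd).partrec.to₂, fun _ h => h⟩,
    fun _ _ => exists_const ℕ |>.symm⟩

theorem exists_computes_oracle (X : ℕ → ℕ) :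
    ∃ T : TuringFunctional, T.Computes X fun n => Part.some (X n) := by
  refine ⟨⟨fun σ n => (σ[n]? : Part ℕ), Computable.list_getElem?.ofOption, fun hp hv => ?_⟩,
    fun n v => ⟨fun hv => ⟨n + 1, Part.mem_coe.2 ?_⟩, ?_⟩⟩
  · exact Part.mem_coe.2 (getElem?_eq_some_of_prefix hp (Part.mem_coe.1 hv))
  · exact Part.mem_some_iff.1 hv ▸ getElem?_initSeg X n.lt_succ_self
  · rintro ⟨s, hv⟩
    obtain ⟨hn, rfl⟩ := List.getElem?_eq_some_iff.1 (Part.mem_coe.1 hv)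
    simp [initSeg]

theorem Computes.exists_of_isEffectiveOperator {K : (ℕ →. ℕ) → (ℕ →. ℕ) → ℕ →. ℕ}
    (hK : IsEffectiveOperator K) (hT : T.Computes X f) (hU : U.Computes X g) :
    ∃ V : TuringFunctional, V.Computes X (K f g) := by
  rw [computes_iff_eventuallyExtends] at hT hU
  refine ⟨⟨fun σ => K (T.run σ) (U.run σ), hK.partrec T.partrec U.partrec,
      fun {σ τ n v} hp hv => ?_⟩,
    computes_iff_eventuallyExtends.2 ⟨fun s => hK.eventuallyExtends (hT.1 s) (hU.1 s),
      hK.eventuallyExtends hT.2 hU.2⟩⟩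
  have hrun (W : TuringFunctional) :
      EventuallyExtends (pure ()) (fun _ => W.run τ) (W.run σ) :=
    fun _ _ h => eventually_pure.2 (W.mono hp h)
  exact eventually_pure.1 (hK.eventuallyExtends (hrun T) (hrun U) n v hv)

theorem exists_computes_of_recursiveIn (hf : Nat.RecursiveIn (oracle X) f) :
    ∃ T : TuringFunctional, T.Computes X f := by
  induction hf with
  | zero => exact exists_computes_of_computable (Computable.const 0) X
  | succ => exact exists_computes_of_computable Computable.succ X
  | left => exact exists_computes_of_computable (Computable.fst.comp Computable.unpair) X
  | right => exact exists_computes_of_computable (Computable.snd.comp Computable.unpair) X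
  | oracle g hg => exact hg ▸ exists_computes_oracle X
  | pair _ _ ihf ihg =>
    obtain ⟨⟨T, hT⟩, U, hU⟩ := ihf, ihg
    exact hT.exists_of_isEffectiveOperator isEffectiveOperator_pair hU
  | comp _ _ ihf ihg =>
    obtain ⟨⟨T, hT⟩, U, hU⟩ := ihf, ihg
    exact hT.exists_of_isEffectiveOperator isEffectiveOperator_comp hU
  | prec _ _ ihf ihg =>
    obtain ⟨⟨T, hT⟩, U, hU⟩ := ihf, ihg
    exact hT.exists_of_isEffectiveOperator isEffectiveOperator_prec hU
  | rfind _ ihf =>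
    obtain ⟨T, hT⟩ := ihf
    exact hT.exists_of_isEffectiveOperator isEffectiveOperator_rfind hT

instance : Countable TuringFunctional := by
  choose code hcode using fun T : TuringFunctional => Nat.Partrec.Code.exists_code.1 T.partrec
  refine Function.Injective.countable (f := code) fun T U h => ?_
  have hrun : T.run = U.run := by
    funext σ n
    have := congrFun ((hcode T).symm.trans ((congrArg _ h).trans (hcode U))) (encode (σ, n))
    simpa [Part.map_id'] using this
  cases T
  cases U
  congr

end TuringFunctional

/-! ### Searching through the finite parts of an oracle -/

section Search

variable {α β σ : Type*} [Primcodable α] [Primcodable β] [Primcodable σ] {O : Set (ℕ →. ℕ)}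

theorem computableIn_comp {f : β → σ} {c : α → β} (hf : ComputableIn O f) (hc : Computable c) :
    ComputableIn O fun a => f (c a) :=
  (Nat.RecursiveIn.comp hf hc.computableIn).of_eq fun n => by
    cases decode (α := α) n <;> simp

theorem recursiveIn_bind {f : α →. β} {g : α × β →. σ} (hf : RecursiveIn O f)
    (hg : RecursiveIn O g) : RecursiveIn O fun a => (f a).bind fun b => g (a, b) :=
  (Nat.RecursiveIn.comp hg (Nat.RecursiveIn.pair
    (RecursiveIn.iff_nat.1 ComputableIn.id.recursiveIn) hf)).of_eq fun n => by
    cases h : decode (α := α) n <;> simp [Seq.seq, h]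

theorem computableIn_comp₂ {f : α → β} {g : α → β → σ} (hf : ComputableIn O f)
    (hg : Computable₂ g) : ComputableIn O fun a => g a (f a) :=
  (recursiveIn_bind hf hg.computableIn).of_eq fun _ => Part.bind_some _ _

theorem recursiveIn_rfind {p : α × ℕ →. Bool} (hp : RecursiveIn O p) :
    RecursiveIn O fun a => Nat.rfind fun n => p (a, n) := by
  have hcode : RecursiveIn O fun q => (p q).map fun b => cond b 0 1 := by
    refine (recursiveIn_bind hp (g := fun q => Part.some (cond q.2 0 1)) ?_).of_eq fun q => ?_
    · exact ((Primrec.dom_bool fun b => cond b 0 1).to_comp.comp Computable.snd).computableIn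
    · exact Part.bind_some_eq_map _ _
  refine (Nat.RecursiveIn.rfind hcode).of_eq fun n => ?_
  cases h : decode (α := α) n with
  | none => simpa [h] using Nat.rfind_zero_none _ rfl
  | some a => simp [h, Part.map_map, Part.map_id']

theorem computableIn_nat_rec (a : α) {h : ℕ → α → α}
    (hh : ComputableIn O fun p : ℕ × α => h p.1 p.2) :
    ComputableIn O fun n => (Nat.rec a h n : α) := by
  have hbase : Nat.RecursiveIn O fun _ => Part.some (encode a) :=
    RecursiveIn.iff_nat.1 (Computable.const (encode a)).computableIn
  have hstep : ComputableIn O fun p : ℕ × ℕ × α => h p.2.1 p.2.2 :=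
    computableIn_comp hh Computable.snd
  have hpair : Nat.RecursiveIn O fun n => Part.some (Nat.pair 0 n) := RecursiveIn.iff_nat.1
    (Primrec₂.natPair.to_comp.comp (Computable.const 0) Computable.id).computableIn
  refine ((hbase.prec hstep).comp hpair).of_eq fun n => ?_
  simp only [Part.bind_eq_bind, Part.bind_some, Nat.unpair_pair, decode_nat, Part.coe_some,
    Part.map_some]
  induction n with
  | zero => rfl
  | succ n ih =>
    simp only [ih]
    simp

theorem computableIn_initSeg (X : ℕ → ℕ) : ComputableIn (oracle X) (initSeg X) := by
  have hX : ComputableIn (oracle X) X := RecursiveIn.oracle _ rfl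
  have happend : ComputableIn (oracle X) fun p : ℕ × List ℕ => p.2 ++ [X p.1] :=
    computableIn_comp₂ (g := fun p x => p.2 ++ [x]) (computableIn_comp hX Computable.fst)
      (Computable.list_concat.comp (Computable.snd.comp Computable.fst) Computable.snd)
  refine (computableIn_nat_rec [] (h := fun y l => l ++ [X y]) happend).of_eq fun n => ?_
  induction n with
  | zero => rfl
  | succ n ih =>
    rw [Part.some_inj] at ih ⊢
    rw [initSeg_succ, ← ih]

theorem recursiveIn_rfindOpt_initSeg {R : List ℕ → α → Option σ} (hR : Computable₂ R)
    (X : ℕ → ℕ) : RecursiveIn (oracle X) fun a => Nat.rfindOpt fun s => R (initSeg X s) a := by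
  have hval : ComputableIn (oracle X) fun p : α × ℕ => R (initSeg X p.2) p.1 :=
    computableIn_comp₂ (g := fun p τ => R τ p.1)
      (computableIn_comp (computableIn_initSeg X) Computable.snd)
      (hR.comp Computable.snd (Computable.fst.comp Computable.fst)).to₂
  have hsome : ComputableIn (oracle X) fun p : α × ℕ => (R (initSeg X p.2) p.1).isSome :=
    computableIn_comp₂ hval (Primrec.option_isSome.to_comp.comp Computable.snd).to₂
  have hget : RecursiveIn (oracle X) fun p : α × ℕ => (R (initSeg X p.2) p.1 : Part σ) :=
    (recursiveIn_bind hval (Computable.ofOption Computable.snd).recursiveIn).of_eq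
      fun _ => Part.bind_some _ _
  exact recursiveIn_bind (recursiveIn_rfind hsome) hget

theorem exists_computable_approx {T : List ℕ → α →. σ} (hT : Partrec₂ T) :
    ∃ R : List ℕ → α → Option σ, Computable₂ R ∧ ∀ (X : ℕ → ℕ) a v,
      (∃ t, v ∈ R (initSeg X t) a) ↔ ∃ s, v ∈ T (initSeg X s) a := by
  obtain ⟨c, hc⟩ := Nat.Partrec.Code.exists_code.1 hT
  have hc_mem {τ : List ℕ} {a : α} {x : ℕ} :
      x ∈ c.eval (encode (τ, a)) ↔ x ∈ (T τ a).map encode := by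
    simp [hc]
  -- The length of `τ` codes both the part of the oracle that is used and a time bound.
  refine ⟨fun τ a => (c.evaln τ.length.unpair.2 (encode (τ.take τ.length.unpair.1, a))).bind decode,
    ?_, fun X a v => ⟨fun ⟨t, hv⟩ => ?_, fun ⟨s, hv⟩ => ?_⟩⟩
  · have hlen : Primrec fun p : List ℕ × α => p.1.length.unpair :=
      Primrec.unpair.comp (Primrec.list_length.comp Primrec.fst)
    exact (Primrec.option_bind (Nat.Partrec.Code.primrec_evaln.comp
      (((Primrec.snd.comp hlen).pair (Primrec.const c)).pair (Primrec.encode.comp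
        ((Primrec.list_take.comp (Primrec.fst.comp hlen) Primrec.fst).pair Primrec.snd))))
      (Primrec.decode.comp Primrec.snd).to₂).to_comp
  · obtain ⟨x, hx, hv⟩ := Option.bind_eq_some_iff.1 hv
    rw [take_initSeg] at hx
    obtain ⟨w, hw, rfl⟩ := (Part.mem_map_iff _).1 (hc_mem.1 (Nat.Partrec.Code.evaln_sound hx))
    rw [encodek, Option.some_inj] at hv
    exact ⟨_, hv ▸ hw⟩
  · obtain ⟨k, hk⟩ := Nat.Partrec.Code.evaln_complete.1 (hc_mem.2 (Part.mem_map encode hv))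
    refine ⟨Nat.pair s k, Option.bind_eq_some_iff.2 ⟨encode v, ?_, encodek v⟩⟩
    simpa [take_initSeg, Nat.left_le_pair] using hk

theorem exists_computableIn_selector {T : List ℕ → α →. σ} (hT : Partrec₂ T) {X : ℕ → ℕ}
    (h : ∀ a, ∃ s, (T (initSeg X s) a).Dom) :
    ∃ f : α → σ, ComputableIn (oracle X) f ∧ ∀ a, ∃ s, f a ∈ T (initSeg X s) a := by
  obtain ⟨R, hR, hRT⟩ := exists_computable_approx hT
  have hdom (a : α) : (Nat.rfindOpt fun t => R (initSeg X t) a).Dom := by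
    obtain ⟨s, hs⟩ := h a
    exact Nat.rfindOpt_dom.2 (exists_comm.1 ⟨_, (hRT X a _).2 ⟨s, Part.get_mem hs⟩⟩)
  refine ⟨fun a => (Nat.rfindOpt fun t => R (initSeg X t) a).get (hdom a),
    (recursiveIn_rfindOpt_initSeg hR X).of_eq fun a => (Part.some_get _).symm, fun a => ?_⟩
  exact (hRT X a _).1 (Nat.rfindOpt_spec (Part.get_mem (hdom a)))

theorem ceIn_of_computablePred {B : ℕ → Bool} {S : Set (List ℕ)} {R : List ℕ → List ℕ → Prop}
    (hR : ComputablePred fun p : List ℕ × List ℕ => R p.1 p.2)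
    (hS : ∀ g, g ∈ S ↔ ∃ s, R (initSeg (charFn B) s) g) : CEIn B S := by
  classical
  have hc : Computable₂ fun (σ g : List ℕ) => bif decide (R σ g) then some () else none :=
    Computable.cond hR.decide (Computable.const (some ())) (Computable.const none)
  refine (recursiveIn_rfindOpt_initSeg hc (charFn B)).of_eq fun g =>
    Part.ext' ?_ fun _ _ => rfl
  rw [Nat.rfindOpt_dom]
  change _ ↔ ∃ _ : g ∈ S, True
  rw [exists_prop, and_true, hS]
  refine exists_congr fun s => ?_
  by_cases h : R (initSeg (charFn B) s) g <;> simp [h]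

theorem CEIn.exists_turingFunctional {B : ℕ → Bool} {S : Set (List ℕ)} (hS : CEIn B S) :
    ∃ T : TuringFunctional, ∀ g,
      g ∈ S ↔ ∃ s, (T.run (initSeg (charFn B) s) (encode g)).Dom := by
  obtain ⟨T, hT⟩ := TuringFunctional.exists_computes_of_recursiveIn hS
  refine ⟨T, fun g => ?_⟩
  rw [← hT.dom_iff]
  simp [Part.assert]

end Search

/-! ### Sets of sequences that depend on finitely many bits -/

section FiniteUse

theorem cantorMeasure_real_cylinder (x : ℕ → Bool) (M : ℕ) :
    cantorMeasure.real (PiNat.cylinder x M) = (2 ^ M)⁻¹ := by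
  rw [PiNat.cylinder_eq_pi, measureReal_def, cantorMeasure,
    Measure.infinitePi_pi _ fun _ _ => .of_discrete]
  simp

theorem existsUnique_lt_two_pow_mem_cylinder_testBit (Z : ℕ → Bool) (M : ℕ) :
    ∃! n, n < 2 ^ M ∧ Z ∈ PiNat.cylinder n.testBit M := by
  simp only [PiNat.mem_cylinder_iff]
  refine ⟨Nat.ofBits fun i : Fin M => Z i, ⟨Nat.ofBits_lt_two_pow _, fun i hi => ?_⟩,
    fun m ⟨hm, hZ⟩ => Nat.eq_of_testBit_eq fun i => ?_⟩
  · rw [Nat.testBit_ofBits_lt _ i hi]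
  rcases lt_or_ge i M with hi | hi
  · rw [Nat.testBit_ofBits_lt _ i hi, hZ i hi]
  · have hM := Nat.pow_le_pow_right two_pos hi
    rw [Nat.testBit_lt_two_pow (hm.trans_le hM),
      Nat.testBit_lt_two_pow ((Nat.ofBits_lt_two_pow _).trans_le hM)]

variable {A : Set (ℕ → Bool)} {M : ℕ}

theorem cylinder_subset_of_dependsOn (hA : DependsOn (· ∈ A) (Set.Iio M)) {x : ℕ → Bool}
    (hx : x ∈ A) : PiNat.cylinder x M ⊆ A := fun _ hy =>
  (hA fun i hi => PiNat.mem_cylinder_iff.1 hy i hi).mpr hx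

theorem measurableSet_of_dependsOn (hA : DependsOn (· ∈ A) (Set.Iio M)) : MeasurableSet A := by
  refine IsOpen.measurableSet (isOpen_iff_forall_mem_open.2 fun x hx => ?_)
  exact ⟨_, cylinder_subset_of_dependsOn hA hx, PiNat.isOpen_cylinder _ x M,
    PiNat.self_mem_cylinder x M⟩

theorem cantorMeasure_real_of_dependsOn (hA : DependsOn (· ∈ A) (Set.Iio M))
    [DecidablePred fun n : ℕ => n.testBit ∈ A] :
    cantorMeasure.real A = Nat.count (fun n => n.testBit ∈ A) (2 ^ M) / 2 ^ M := by
  have hunion : A = ⋃ n ∈ {n ∈ Finset.range (2 ^ M) | n.testBit ∈ A},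
      PiNat.cylinder n.testBit M := by
    ext Z
    simp only [Finset.mem_filter, Finset.mem_range, Set.mem_iUnion, exists_prop]
    refine ⟨fun hZ => ?_, fun ⟨n, ⟨_, hn⟩, hZn⟩ => cylinder_subset_of_dependsOn hA hn hZn⟩
    obtain ⟨n, ⟨hn, hZn⟩, -⟩ := existsUnique_lt_two_pow_mem_cylinder_testBit Z M
    exact ⟨n, ⟨hn, cylinder_subset_of_dependsOn hA hZ ((PiNat.mem_cylinder_comm _ _ _).1 hZn)⟩,
      hZn⟩
  have hdisj : ({n ∈ Finset.range (2 ^ M) | n.testBit ∈ A} : Set ℕ).PairwiseDisjoint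
      fun n => PiNat.cylinder n.testBit M := by
    intro m hm n hn hmn
    refine Set.disjoint_left.2 fun Z hZm hZn => hmn ?_
    exact (existsUnique_lt_two_pow_mem_cylinder_testBit Z M).unique
      ⟨Finset.mem_range.1 hm.1, hZm⟩ ⟨Finset.mem_range.1 hn.1, hZn⟩
  conv_lhs => rw [hunion]
  rw [measureReal_biUnion_finset (by simpa using hdisj)
    fun n _ => (PiNat.isOpen_cylinder _ _ M).measurableSet]
  simp [cantorMeasure_real_cylinder, Nat.count_eq_card_filter_range, div_eq_mul_inv]

end FiniteUse

theorem eventually_measureReal_lt_of_iInter_eq_empty {α : Type*} [MeasurableSpace α]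
    {μ : Measure α} [IsFiniteMeasure μ] {s : ℕ → Set α} (hs : ∀ n, NullMeasurableSet (s n) μ)
    (hanti : Antitone s) (hempty : ⋂ n, s n = ∅) {δ : ℝ} (hδ : 0 < δ) :
    ∀ᶠ n in atTop, μ.real (s n) < δ := by
  have hlim := tendsto_measure_iInter_atTop hs hanti ⟨0, measure_ne_top _ _⟩
  rw [hempty, measure_empty] at hlim
  exact ((ENNReal.tendsto_toReal ENNReal.zero_ne_top).comp hlim).eventually_lt_const
    (by simpa using hδ)

/-! ### Convergence sets -/

section Convergence

variable {α : Type} {Φ : Functional} {B : ℕ → Bool}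

theorem initSeg_join_congr {X X' Y Y' : ℕ → α} {s t : ℕ} (hX : ∀ i < s, X i = X' i)
    (hY : ∀ i < s, Y i = Y' i) (ht : t ≤ 2 * s) :
    initSeg (join X Y) t = initSeg (join X' Y') t := by
  refine initSeg_congr fun i hi => ?_
  simp only [join, hX (i / 2) (by omega), hY (i / 2) (by omega)]

theorem Functional.stage_mono (Z : ℕ → Bool) {k s t : ℕ} (hst : s ≤ t)
    (h : (Φ.stage Z k s).isSome) : (Φ.stage Z k t).isSome := by
  obtain ⟨v, hv⟩ := Option.isSome_iff_exists.1 h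
  exact Option.isSome_iff_exists.2 ⟨v, Φ.mono _ _ _ _ (initSeg_prefix Z hst) hv⟩

/-- The set of all `Z` such that `Φ(B ⊕ Z; k)` converges by stage `s`. -/
def convBy (Φ : Functional) (B : ℕ → Bool) (k s : ℕ) : Set (ℕ → Bool) :=
  {Z | (Φ.stage (join B Z) k s).isSome}

/-- The set of all `Z` such that `Φ(B ⊕ Z; k)` converges. -/
def conv (Φ : Functional) (B : ℕ → Bool) (k : ℕ) : Set (ℕ → Bool) := ⋃ s, convBy Φ B k s

theorem monotone_convBy (k : ℕ) : Monotone (convBy Φ B k) :=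
  fun _ _ hst Z hZ => Φ.stage_mono (join B Z) hst hZ

theorem mem_bounded_iff {a : ℕ} {g : List ℕ} {Z : ℕ → Bool} :
    Z ∈ bounded Φ B a g ↔ ∀ k < g.length, a ≤ k → Z ∈ convBy Φ B k (g.getD k 0) :=
  forall₂_congr fun k hk => by rw [List.getD_eq_getElem _ _ hk]; rfl

theorem dom_eq_iInter_conv : dom Φ B = ⋂ k, conv Φ B k := by
  ext
  simp [dom, conv, convBy]

theorem dependsOn_mem_convBy (k s : ℕ) : DependsOn (· ∈ convBy Φ B k s) (Set.Iio s) :=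
  fun Y Z h => congrArg (fun σ => (Φ.approx σ k).isSome = true)
    (initSeg_join_congr (t := s) (fun _ _ => rfl) h (by omega))

theorem dependsOn_mem_bounded (a : ℕ) {g : List ℕ} {M : ℕ} (hg : ∀ x ∈ g, x ≤ M) :
    DependsOn (· ∈ bounded Φ B a g) (Set.Iio M) := fun Y Z h => by
  simp only [mem_bounded_iff, eq_iff_iff]
  refine forall₃_congr fun k hk _ => Eq.to_iff (dependsOn_mem_convBy k _ fun i hi => h i ?_)
  rw [List.getD_eq_getElem _ _ hk] at hi
  exact hi.trans_le (hg _ (List.getElem_mem hk))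

theorem measurableSet_convBy (k s : ℕ) : MeasurableSet (convBy Φ B k s) :=
  measurableSet_of_dependsOn (dependsOn_mem_convBy k s)

theorem measurableSet_conv (k : ℕ) : MeasurableSet (conv Φ B k) :=
  .iUnion fun s => measurableSet_convBy k s

theorem measurableSet_dom : MeasurableSet (dom Φ B) :=
  dom_eq_iInter_conv ▸ .iInter fun k => measurableSet_conv k

theorem measurableSet_bounded (a : ℕ) (g : List ℕ) : MeasurableSet (bounded Φ B a g) :=
  measurableSet_of_dependsOn (dependsOn_mem_bounded a fun _ => List.le_sum_of_mem)

theorem dom_subset_conv (k : ℕ) : dom Φ B ⊆ conv Φ B k :=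
  dom_eq_iInter_conv.trans_subset (Set.iInter_subset _ k)

theorem bounded_subset_conv {a k : ℕ} {g : List ℕ} (hk : k < g.length) (hak : a ≤ k) :
    bounded Φ B a g ⊆ conv Φ B k := fun _ hZ =>
  Set.mem_iUnion.2 ⟨_, mem_bounded_iff.1 hZ k hk hak⟩

theorem bounded_concat (g : List ℕ) (s : ℕ) :
    bounded Φ B g.length (g ++ [s]) = convBy Φ B g.length s := by
  ext Z
  rw [mem_bounded_iff]
  refine ⟨fun h => by simpa using h g.length (by simp) le_rfl, fun h k hk hak => ?_⟩
  obtain rfl : k = g.length := by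
    rw [List.length_append, List.length_singleton] at hk
    omega
  simpa using h

theorem antitone_conv (hΦ : Φ.Standard) : Antitone (conv Φ B) := by
  intro m n hmn Z hZ
  rcases hmn.eq_or_lt with rfl | hlt
  · exact hZ
  obtain ⟨s, hs⟩ := Set.mem_iUnion.1 hZ
  obtain ⟨v, hv⟩ := Option.isSome_iff_exists.1 hs
  exact Set.mem_iUnion.2 ⟨s, (hΦ _ _ _ _ hv).2 m hlt⟩

theorem eventually_conv_diff_dom_lt (hΦ : Φ.Standard) (B : ℕ → Bool) {δ : ℝ} (hδ : 0 < δ) :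
    ∀ᶠ n in atTop, cantorMeasure.real (conv Φ B n \ dom Φ B) < δ := by
  refine eventually_measureReal_lt_of_iInter_eq_empty
    (fun n => ((measurableSet_conv n).diff measurableSet_dom).nullMeasurableSet)
    (fun m n h => Set.sdiff_subset_sdiff_left (antitone_conv hΦ h)) ?_ hδ
  refine Set.eq_empty_of_forall_notMem fun Z hZ => ?_
  rw [Set.mem_iInter] at hZ
  exact (hZ 0).2 (dom_eq_iInter_conv ▸ Set.mem_iInter.2 fun n => (hZ n).1)

theorem eventually_dom_diff_convBy_lt (Φ : Functional) (B : ℕ → Bool) (k : ℕ) {δ : ℝ}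
    (hδ : 0 < δ) : ∀ᶠ s in atTop, cantorMeasure.real (dom Φ B \ convBy Φ B k s) < δ := by
  refine eventually_measureReal_lt_of_iInter_eq_empty
    (fun s => (measurableSet_dom.diff (measurableSet_convBy k s)).nullMeasurableSet)
    (fun s t h => Set.sdiff_subset_sdiff_right (monotone_convBy k h)) ?_ hδ
  refine Set.eq_empty_of_forall_notMem fun Z hZ => ?_
  rw [Set.mem_iInter] at hZ
  obtain ⟨s, hs⟩ := (hZ 0).1 k
  exact (hZ s).2 hs

end Convergence

/-! ### Approximating the measure of bounded convergence sets -/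

section Primrec

variable {α : Type*} [Primcodable α]

theorem computablePred_and {p q : α → Prop} (hp : ComputablePred p) (hq : ComputablePred q) :
    ComputablePred fun a => p a ∧ q a := by
  classical
  exact ((Primrec.and.to_comp.comp hp.decide hq.decide).of_eq fun a => by simp).computablePred

theorem computable_count {p : α → ℕ → Prop} [∀ a, DecidablePred (p a)] {b : α → ℕ}
    (hp : ComputablePred fun x : α × ℕ => p x.1 x.2) (hb : Computable b) :
    Computable fun a => Nat.count (p a) (b a) := by
  have hstep : Computable₂ fun (a : α) (y : ℕ × ℕ) => y.2 + bif decide (p a y.1) then 1 else 0 :=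
    Primrec.nat_add.to_comp.comp (Computable.snd.comp Computable.snd)
      (Computable.cond (hp.decide.comp
        (Computable.fst.pair (Computable.fst.comp Computable.snd)))
        (Computable.const 1) (Computable.const 0))
  refine (Computable.nat_rec hb (Computable.const 0) hstep).of_eq fun a => ?_
  induction b a with
  | zero => rfl
  | succ n ih => simp [Nat.count_succ, ← ih]

theorem computablePred_forall_lt {p : α → ℕ → Prop} {b : α → ℕ}
    (hp : ComputablePred fun x : α × ℕ => p x.1 x.2) (hb : Computable b) :
    ComputablePred fun a => ∀ k < b a, p a k := by
  classical
  exact (Primrec.eq.decide.to_comp.comp (computable_count hp hb) hb).computablePred.of_eq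
    fun a => Nat.count_iff_forall

theorem primrec_two_pow : Primrec fun n : ℕ => 2 ^ n :=
  (Primrec₂.unpaired'.1 Nat.Primrec.pow).comp (Primrec.const 2) Primrec.id

theorem primrec_testBit : Primrec₂ Nat.testBit := by
  have hbit : PrimrecPred fun p : ℕ × ℕ => p.1 / 2 ^ p.2 % 2 = 1 :=
    Primrec.eq.comp (Primrec.nat_mod.comp (Primrec.nat_div.comp Primrec.fst
      (primrec_two_pow.comp Primrec.snd)) (Primrec.const 2)) (Primrec.const 1)
  exact hbit.decide.of_eq fun p => Nat.testBit_eq_decide_div_mod_eq.symm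

theorem primrec_initSeg_join {β : Type} [Primcodable β] {X Y : α → ℕ → β} {b : α → ℕ}
    (hX : Primrec₂ X) (hY : Primrec₂ Y) (hb : Primrec b) :
    Primrec fun a => initSeg (join (X a) (Y a)) (b a) := by
  have hhalf : Primrec fun p : α × ℕ => p.2 / 2 :=
    Primrec.nat_div.comp Primrec.snd (Primrec.const 2)
  exact Primrec.list_map (Primrec.list_range.comp hb) (Primrec.ite
    (Primrec.eq.comp (Primrec.nat_mod.comp Primrec.snd (Primrec.const 2)) (Primrec.const 0))
    (hX.comp Primrec.fst hhalf) (hY.comp Primrec.fst hhalf))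

end Primrec

section Threshold

/-- The set whose characteristic function starts with `σ` and vanishes afterwards. It stands in for
`B` in computations that know only a finite part `σ` of `B`. -/
def strSet (σ : List ℕ) : ℕ → Bool := fun i => σ.getD i 0 == 1

theorem strSet_initSeg_charFn (B : ℕ → Bool) {s i : ℕ} (hi : i < s) :
    strSet (initSeg (charFn B) s) i = B i := by
  rw [strSet, getD_initSeg _ hi, charFn]
  cases B i <;> rfl

theorem bounded_congr {Φ : Functional} {B C : ℕ → Bool} {M : ℕ} (hBC : ∀ i < M, B i = C i)
    (a : ℕ) {g : List ℕ} (hg : ∀ x ∈ g, x ≤ M) : bounded Φ B a g = bounded Φ C a g := by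
  ext Z
  refine forall₃_congr fun k hk _ => ?_
  have hgk : g[k] ≤ M := hg _ (List.getElem_mem hk)
  exact Eq.to_iff <| congrArg (fun σ => (Φ.approx σ k).isSome = true)
    (initSeg_join_congr hBC (fun _ _ => rfl) (by omega))

theorem ratCast_le_natCast_div_iff (q : ℚ) (c : ℕ) {k : ℕ} (hk : 0 < k) :
    (q : ℝ) ≤ (c : ℝ) / k ↔ q.num.toNat * k ≤ c * q.den := by
  rw [Rat.cast_def, div_le_div_iff₀ (by exact_mod_cast q.den_pos) (by exact_mod_cast hk)]
  norm_cast
  zify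
  rw [Int.ofNat_toNat]
  rcases le_or_gt 0 q.num with h | h
  · rw [max_eq_left h]
  · rw [max_eq_right h.le, zero_mul]
    exact iff_of_true ((mul_nonpos_of_nonpos_of_nonneg h.le (by positivity)).trans (by positivity))
      (by positivity)

theorem computablePred_testBit_mem_bounded (Φ : Functional) (a : ℕ) :
    ComputablePred fun p : (List ℕ × List ℕ) × ℕ =>
      p.2.testBit ∈ bounded Φ (strSet p.1.1) a p.1.2 := by
  have hget {γ : Type} [Primcodable γ] {f : γ → List ℕ} (hf : Primrec f) :
      Primrec₂ fun c i => (f c).getD i 0 :=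
    (Primrec.list_getD 0).comp (hf.comp Primrec.fst) Primrec.snd
  have hentry : Primrec fun p : ((List ℕ × List ℕ) × ℕ) × ℕ => p.1.1.2.getD p.2 0 :=
    (hget (Primrec.snd.comp (Primrec.fst.comp Primrec.fst))).comp Primrec.id Primrec.snd
  have hset : Primrec₂ fun (p : ((List ℕ × List ℕ) × ℕ) × ℕ) i => strSet p.1.1.1 i :=
    Primrec.beq.comp (hget (Primrec.fst.comp (Primrec.fst.comp Primrec.fst))) (Primrec.const 1)
  have hbits : Primrec₂ fun (p : ((List ℕ × List ℕ) × ℕ) × ℕ) i => p.1.2.testBit i :=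
    primrec_testBit.comp (Primrec.snd.comp (Primrec.fst.comp Primrec.fst)) Primrec.snd
  have hconv : Computable fun p : ((List ℕ × List ℕ) × ℕ) × ℕ =>
      (Φ.stage (join (strSet p.1.1.1) p.1.2.testBit) p.2 (p.1.1.2.getD p.2 0)).isSome :=
    Primrec.option_isSome.to_comp.comp (Φ.computable.comp
      (primrec_initSeg_join hset hbits hentry).to_comp Computable.snd)
  have hlt : Computable fun p : ((List ℕ × List ℕ) × ℕ) × ℕ => decide (p.2 < a) :=
    (Primrec.nat_lt.decide.comp Primrec.snd (Primrec.const a)).to_comp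
  have himp : ComputablePred fun p : ((List ℕ × List ℕ) × ℕ) × ℕ => a ≤ p.2 →
      p.1.2.testBit ∈ convBy Φ (strSet p.1.1.1) p.2 (p.1.1.2.getD p.2 0) :=
    ComputablePred.computable_iff.2 ⟨_, Primrec.or.to_comp.comp hlt hconv, funext fun p => by
      simp only [convBy, Set.mem_ofPred_eq, Bool.or_eq_true, decide_eq_true_eq,
        imp_iff_not_or, not_le]⟩
  exact (computablePred_forall_lt (p := fun (p : (List ℕ × List ℕ) × ℕ) k => a ≤ k →
    p.2.testBit ∈ convBy Φ (strSet p.1.1) k (p.1.2.getD k 0)) himp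
    (Primrec.list_length.comp (Primrec.snd.comp Primrec.fst)).to_comp).of_eq
    fun p => mem_bounded_iff.symm

/-- The strings `g` that properly extend `f`, have length at least `l`, and for which the measure of
`D_{[|f|, |g|)}[g]` is at least `q`. -/
def largeStrings (Φ : Functional) (B : ℕ → Bool) (f : List ℕ) (l : ℕ) (q : ℚ) : Set (List ℕ) :=
  {g | (f <+: g ∧ f.length < g.length ∧ l ≤ g.length) ∧
    (q : ℝ) ≤ cantorMeasure.real (bounded Φ B f.length g)}

theorem computablePred_mem_largeStrings (Φ : Functional) (f : List ℕ) (l : ℕ) (q : ℚ) :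
    ComputablePred fun p : List ℕ × List ℕ =>
      (∀ x ∈ p.2, x ≤ p.1.length) ∧ p.2 ∈ largeStrings Φ (strSet p.1) f l q := by
  classical
  have hlen : Primrec fun p : List ℕ × List ℕ => p.2.length :=
    Primrec.list_length.comp Primrec.snd
  have hpow : Primrec fun p : List ℕ × List ℕ => 2 ^ p.1.length :=
    primrec_two_pow.comp (Primrec.list_length.comp Primrec.fst)
  have hbound : PrimrecPred fun p : List ℕ × List ℕ => ∀ x ∈ p.2, x ≤ p.1.length :=
    PrimrecRel.comp (PrimrecRel.forall_mem_list Primrec.nat_le)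
      Primrec.snd (Primrec.list_length.comp Primrec.fst)
  have hlong : PrimrecPred fun p : List ℕ × List ℕ =>
      p.2.take f.length = f ∧ f.length < p.2.length ∧ l ≤ p.2.length :=
    (Primrec.eq.comp (Primrec.list_take.comp (Primrec.const f.length) Primrec.snd)
      (Primrec.const f)).and
      ((Primrec.nat_lt.comp (Primrec.const _) hlen).and
        (Primrec.nat_le.comp (Primrec.const _) hlen))
  have hcount : ComputablePred fun p : List ℕ × List ℕ => q.num.toNat * 2 ^ p.1.length ≤
      Nat.count (fun n => n.testBit ∈ bounded Φ (strSet p.1) f.length p.2) (2 ^ p.1.length) *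
        q.den :=
    (Primrec.nat_le.decide.to_comp.comp (Primrec.nat_mul.comp (Primrec.const _) hpow).to_comp
      (Primrec.nat_mul.to_comp.comp (computable_count
        (computablePred_testBit_mem_bounded Φ f.length) hpow.to_comp)
        (Computable.const _))).computablePred
  refine (computablePred_and hbound.computablePred
    (computablePred_and hlong.computablePred hcount)).of_eq fun p => and_congr_right fun hp => ?_
  refine and_congr (and_congr_left' (eq_comm.trans List.prefix_iff_eq_take.symm)) ?_
  rw [cantorMeasure_real_of_dependsOn (dependsOn_mem_bounded f.length hp),
    ← ratCast_le_natCast_div_iff q _ (by positivity)]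
  norm_cast

theorem ceIn_largeStrings (Φ : Functional) (B : ℕ → Bool) (f : List ℕ) (l : ℕ) (q : ℚ) :
    CEIn B (largeStrings Φ B f l q) := by
  refine ceIn_of_computablePred (R := fun σ g =>
    (∀ x ∈ g, x ≤ σ.length) ∧ g ∈ largeStrings Φ (strSet σ) f l q)
    (computablePred_mem_largeStrings Φ f l q) fun g => ?_
  have huse {s : ℕ} (hs : ∀ x ∈ g, x ≤ s) :
      g ∈ largeStrings Φ (strSet (initSeg (charFn B) s)) f l q ↔ g ∈ largeStrings Φ B f l q := by
    rw [largeStrings, Set.mem_ofPred_eq,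
      bounded_congr (fun i hi => strSet_initSeg_charFn B hi) f.length hs]
    rfl
  simp only [length_initSeg]
  exact ⟨fun hg => ⟨g.sum, fun _ => List.le_sum_of_mem, (huse fun _ => List.le_sum_of_mem).2 hg⟩,
    fun ⟨_, hs, hg⟩ => (huse hs).1 hg⟩

end Threshold

/-! ### The technical lemma -/

section TechnicalLemma

variable {Φ : Functional} {B : ℕ → Bool}

theorem Condition.exists_le_str_eq (p : Condition Φ B) {g : List ℕ} (hg : p.str <+: g)
    (hlt : cantorMeasure.real (dom Φ B \ bounded Φ B p.str.length g) < p.eps) :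
    ∃ q ≤ p, q.str = g := by
  obtain ⟨ε, hε₀, hε⟩ := exists_rat_btwn (sub_pos.2 hlt)
  have hle : (ε : ℝ) ≤ p.eps := hε.le.trans (sub_le_self _ measureReal_nonneg)
  exact ⟨⟨g, ε, by exact_mod_cast hε₀⟩,
    ⟨hg, by exact_mod_cast hle, fun _ => lt_sub_iff_add_lt'.1 hε⟩, rfl⟩

theorem Condition.exists_le_length (p : Condition Φ B) (n : ℕ) :
    ∃ q ≤ p, n ≤ q.str.length := by
  induction n with
  | zero => exact ⟨p, le_rfl, Nat.zero_le _⟩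
  | succ n ih =>
    obtain ⟨q, hq, hn⟩ := ih
    have hε : (0 : ℝ) < q.eps := by exact_mod_cast q.eps_pos
    obtain ⟨s, hs⟩ := (eventually_dom_diff_convBy_lt Φ B q.str.length hε).exists
    rw [← bounded_concat] at hs
    obtain ⟨r, hr, hrs⟩ := q.exists_le_str_eq (List.prefix_append _ _) hs
    exact ⟨r, hr.trans hq, by simpa [hrs] using hn⟩

theorem cantorMeasure_real_dom_diff_bounded_le {a n : ℕ} {g : List ℕ} (han : a ≤ n)
    (hn : n < g.length) : cantorMeasure.real (dom Φ B \ bounded Φ B a g) ≤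
      cantorMeasure.real (dom Φ B) + cantorMeasure.real (conv Φ B n \ dom Φ B) -
        cantorMeasure.real (bounded Φ B a g) := by
  have hle : cantorMeasure.real (dom Φ B \ bounded Φ B a g) ≤
      cantorMeasure.real (conv Φ B n \ bounded Φ B a g) :=
    measureReal_mono (Set.sdiff_subset_sdiff_left (dom_subset_conv n))
  have hconv : cantorMeasure.real (conv Φ B n \ bounded Φ B a g) =
      cantorMeasure.real (conv Φ B n) - cantorMeasure.real (bounded Φ B a g) :=
    measureReal_sdiff (bounded_subset_conv hn han) (measurableSet_bounded a g)
  have hdom : cantorMeasure.real (conv Φ B n \ dom Φ B) =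
      cantorMeasure.real (conv Φ B n) - cantorMeasure.real (dom Φ B) :=
    measureReal_sdiff (dom_subset_conv n) measurableSet_dom
  linarith

theorem Condition.exists_ceIn_denseBelow (hΦ : Φ.Standard) (p : Condition Φ B) :
    ∃ S : Set (List ℕ), CEIn B S ∧ (∀ g ∈ S, ∃ q ≤ p, q.str = g) ∧
      ∃ p' ≤ p, DenseBelow p' {q | q ≤ p' ∧ q.str ∈ S} := by
  have hε : (0 : ℝ) < p.eps := by exact_mod_cast p.eps_pos
  obtain ⟨n₀, hn₀⟩ := eventually_atTop.1
    (eventually_conv_diff_dom_lt hΦ B (δ := p.eps / 4) (by positivity))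
  obtain ⟨q, hq₁, hq₂⟩ := exists_rat_btwn (show
    cantorMeasure.real (dom Φ B) - 3 * p.eps / 4 < cantorMeasure.real (dom Φ B) - p.eps / 2 by
      linarith)
  refine ⟨largeStrings Φ B p.str (n₀ + 1) q, ceIn_largeStrings Φ B _ _ q, ?_,
    ⟨p.str, p.eps / 2, half_pos p.eps_pos⟩,
    ⟨List.prefix_rfl, (half_lt_self p.eps_pos).le, fun h => absurd rfl h⟩, fun r hr => ?_⟩
  · rintro g ⟨⟨hpg, hlen, hn⟩, hlarge⟩
    refine p.exists_le_str_eq hpg ?_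
    have hdiff := cantorMeasure_real_dom_diff_bounded_le (Φ := Φ) (B := B)
      (Nat.le_sub_one_of_lt hlen) (Nat.sub_one_lt_of_lt hn)
    linarith [hn₀ (g.length - 1) (Nat.le_sub_one_of_lt hn)]
  · obtain ⟨t, ht, hlen⟩ := r.exists_le_length (max (p.str.length + 1) (n₀ + 1))
    rw [max_le_iff] at hlen
    have htp := ht.trans hr
    refine ⟨t, ht, htp, ⟨htp.1, hlen⟩, ?_⟩
    have hdiff : cantorMeasure.real (dom Φ B \ bounded Φ B p.str.length t.str) + t.eps <
        (p.eps / 2 : ℚ) := htp.2.2 fun h => (Nat.lt_of_succ_le hlen.1).ne (congrArg List.length h)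
    have ht_pos : (0 : ℝ) < t.eps := by exact_mod_cast t.eps_pos
    have hle := le_measureReal_sdiff (μ := cantorMeasure) (s₁ := dom Φ B)
      (s₂ := bounded Φ B p.str.length t.str)
    push_cast at hdiff
    linarith

end TechnicalLemma

/-! ### Oracle computations from conditions -/

section JoinStr

/-- The longest initial segment of `X ⊕ f` that is determined by the initial segment `g` of `f`. -/
def joinStr (X : ℕ → ℕ) (g : List ℕ) : List ℕ :=
  initSeg (join X fun i => g.getD i 0) (2 * g.length)

theorem joinStr_congr {X Y : ℕ → ℕ} {g : List ℕ} (h : ∀ i < g.length, X i = Y i) :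
    joinStr X g = joinStr Y g :=
  initSeg_join_congr h (fun _ _ => rfl) le_rfl

theorem joinStr_initSeg (X f : ℕ → ℕ) (m : ℕ) :
    joinStr X (initSeg f m) = initSeg (join X f) (2 * m) := by
  rw [joinStr, length_initSeg]
  exact initSeg_join_congr (fun _ _ => rfl) (fun _ hi => getD_initSeg f hi 0) le_rfl

theorem joinStr_prefix (X : ℕ → ℕ) {g h : List ℕ} (hgh : g <+: h) :
    joinStr X g <+: joinStr X h := by
  have hg : g = initSeg (fun i => h.getD i 0) g.length := by
    refine List.ext_getElem (by simp) fun i hi _ => ?_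
    simp [initSeg, hgh.getElem hi, List.getElem?_eq_getElem (hi.trans_le hgh.length_le)]
  rw [hg, joinStr_initSeg]
  exact initSeg_prefix _ (Nat.mul_le_mul_left 2 hgh.length_le)

theorem primrec_joinStr : Primrec₂ fun σ g : List ℕ => joinStr (fun i => σ.getD i 0) g :=
  primrec_initSeg_join
    ((Primrec.list_getD 0).comp (Primrec.fst.comp Primrec.fst) Primrec.snd)
    ((Primrec.list_getD 0).comp (Primrec.snd.comp Primrec.fst) Primrec.snd)
    (Primrec.nat_mul.comp (Primrec.const 2) (Primrec.list_length.comp Primrec.snd))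

theorem CEIn.exists_partrec_mem_iff {B : ℕ → Bool} {S : Set (List ℕ)} (hS : CEIn B S)
    (T : TuringFunctional) : ∃ V : List ℕ → ℕ →. ℕ, Partrec₂ V ∧ ∀ n v,
      (∃ s, v ∈ V (initSeg (charFn B) s) n) ↔ ∃ g ∈ S, v ∈ T.run (joinStr (charFn B) g) n := by
  obtain ⟨U, hU⟩ := hS.exists_turingFunctional
  -- The length of `σ` codes the string `g` that is tried.
  let g (s : ℕ) : List ℕ := Denumerable.ofNat (List ℕ) s.unpair.2
  have hg : Computable fun σ : List ℕ => g σ.length := (Computable.ofNat _).comp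
    (Computable.snd.comp (Computable.unpair.comp Computable.list_length))
  let V (σ : List ℕ) (n : ℕ) : Part ℕ := (U.run σ (encode (g σ.length))).bind fun _ =>
    T.run (joinStr (fun i => σ.getD i 0) (g σ.length)) n
  have hV : Partrec₂ V := by
    have hσ : Computable fun q : (List ℕ × ℕ) × ℕ => q.1.1 := Computable.fst.comp Computable.fst
    exact (U.partrec.comp Computable.fst (Computable.encode.comp (hg.comp Computable.fst))).bind
      (T.partrec.comp (primrec_joinStr.to_comp.comp hσ (hg.comp hσ))
        (Computable.snd.comp Computable.fst))
  have hjoin (s : ℕ) :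
      joinStr (fun i => (initSeg (charFn B) s).getD i 0) (g s) = joinStr (charFn B) (g s) := by
    have hlen : (g s).length ≤ s := by
      refine (Encodable.length_le_encode _).trans ?_
      rw [Denumerable.encode_ofNat]
      exact Nat.unpair_right_le s
    exact joinStr_congr fun i hi => getD_initSeg _ (hi.trans_le hlen) 0
  have hmem (s n v : ℕ) : v ∈ V (initSeg (charFn B) s) n ↔
      (U.run (initSeg (charFn B) s) (encode (g s))).Dom ∧
        v ∈ T.run (joinStr (charFn B) (g s)) n := by
    simp only [V, length_initSeg, hjoin, Part.mem_bind_iff, exists_and_right, Part.dom_iff_mem]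
  refine ⟨V, hV, fun n v => ⟨fun ⟨s, hs⟩ => ?_, fun ⟨τ, hτ, hv⟩ => ?_⟩⟩
  · obtain ⟨hdom, hv⟩ := (hmem s n v).1 hs
    exact ⟨g s, (hU _).2 ⟨s, hdom⟩, hv⟩
  · obtain ⟨s, hs⟩ := (hU τ).1 hτ
    have hgτ : g (Nat.pair s (encode τ)) = τ := by simp [g]
    refine ⟨Nat.pair s (encode τ), (hmem _ n v).2 ?_⟩
    rw [hgτ]
    exact ⟨U.mono_dom (initSeg_prefix _ (Nat.left_le_pair _ _)) hs, hv⟩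

theorem CEIn.exists_computableIn_selector {B : ℕ → Bool} {S : Set (List ℕ)} (hS : CEIn B S)
    (T : TuringFunctional) (h : ∀ n, ∃ g ∈ S, (T.run (joinStr (charFn B) g) n).Dom) :
    ∃ f : ℕ → ℕ, ComputableIn (oracle (charFn B)) f ∧
      ∀ n, ∃ g ∈ S, f n ∈ T.run (joinStr (charFn B) g) n := by
  obtain ⟨V, hV, hmem⟩ := hS.exists_partrec_mem_iff T
  obtain ⟨f, hf, hfV⟩ := AEDomination.exists_computableIn_selector hV (X := charFn B) fun n => by
    obtain ⟨g, hg, hdom⟩ := h n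
    obtain ⟨s, hs⟩ := (hmem n _).2 ⟨g, hg, Part.get_mem hdom⟩
    exact ⟨s, Part.dom_iff_mem.2 ⟨_, hs⟩⟩
  exact ⟨f, hf, fun n => (hmem n _).1 (hfV n)⟩

end JoinStr

/-! ### Generic filters -/

section Generic

variable {Φ : Functional} {B : ℕ → Bool} {A : ℕ → Set ℕ} {G : Order.PFilter (Condition Φ B)}
  {f : ℕ → ℕ}

/-- `X` computes a choice function for the sets `A n`. Both DNR degrees and PA degrees are described
by families that can be selected from. -/
def ComputesSelector (X : ℕ → ℕ) (A : ℕ → Set ℕ) : Prop :=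
  ∃ h : ℕ → ℕ, (∀ n, h n ∈ A n) ∧ ComputableIn (oracle X) h

/-- The conditions `q` that force `T`, with the oracle `B ⊕ f^G`, not to be a choice function for
the sets `A n`: either `T` already gives a value outside `A n` from the part of the oracle
determined by `q`, or no extension of `q` makes `T` converge on some fixed argument. -/
def avoidsSelection (Φ : Functional) (B : ℕ → Bool) (A : ℕ → Set ℕ) (T : TuringFunctional) :
    Set (Condition Φ B) :=
  {q | (∃ n, ∃ v ∈ T.run (joinStr (charFn B) q.str) n, v ∉ A n) ∨
    ∃ n, ∀ r ≤ q, ¬(T.run (joinStr (charFn B) r.str) n).Dom}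

theorem isDense_avoidsSelection (hΦ : Φ.Standard) (hB : ¬ComputesSelector (charFn B) A)
    (T : TuringFunctional) : IsDense (avoidsSelection Φ B A T) := by
  intro p
  obtain ⟨S, hS, hSp, p', hp', hdense⟩ := p.exists_ceIn_denseBelow hΦ
  by_cases hbad : ∃ g ∈ S, ∃ n, ∃ v ∈ T.run (joinStr (charFn B) g) n, v ∉ A n
  · obtain ⟨g, hg, hgbad⟩ := hbad
    obtain ⟨q, hq, rfl⟩ := hSp g hg
    exact ⟨q, hq, Or.inl hgbad⟩
  push Not at hbad
  refine ⟨p', hp', Or.inr ?_⟩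
  by_contra! hconv
  -- `B` can search `S` for values of `T`, all of which are good.
  obtain ⟨h, hh, hhS⟩ := hS.exists_computableIn_selector T fun n => by
    obtain ⟨r, hr, hrn⟩ := hconv n
    obtain ⟨q, hq, -, hqS⟩ := hdense r hr
    exact ⟨q.str, hqS, T.mono_dom (joinStr_prefix _ hq.1) hrn⟩
  refine hB ⟨h, fun n => ?_, hh⟩
  obtain ⟨g, hg, hv⟩ := hhS n
  exact hbad g hg n _ hv

theorem exists_isGenericFunction (hG : ∀ n, ∃ p ∈ G, n ≤ p.str.length) :
    ∃ f, IsGenericFunction G f := by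
  have hex (n : ℕ) : ∃ m, ∃ p ∈ G, p.str[n]? = some m := by
    obtain ⟨p, hp, hn⟩ := hG (n + 1)
    exact ⟨p.str[n], p, hp, List.getElem?_eq_getElem hn⟩
  choose f hf using hex
  refine ⟨f, fun n m => ⟨fun h => h ▸ hf n, fun ⟨q, hq, hm⟩ => ?_⟩⟩
  obtain ⟨p, hp, hfn⟩ := hf n
  obtain ⟨r, -, hrp, hrq⟩ := G.directed p hp q hq
  exact Option.some_injective _ ((getElem?_eq_some_of_prefix hrp.1 hfn).symm.trans
    (getElem?_eq_some_of_prefix hrq.1 hm))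

theorem IsGenericFunction.str_eq (hf : IsGenericFunction G f) {p : Condition Φ B} (hp : p ∈ G) :
    p.str = initSeg f p.str.length := by
  refine List.ext_getElem (by simp) fun i hi _ => ?_
  simp [initSeg, (hf i p.str[i]).2 ⟨p, hp, List.getElem?_eq_getElem hi⟩]

theorem IsGenericFunction.joinStr_str (hf : IsGenericFunction G f) {p : Condition Φ B}
    (hp : p ∈ G) (X : ℕ → ℕ) : joinStr X p.str = initSeg (join X f) (2 * p.str.length) :=
  (congrArg _ (hf.str_eq hp)).trans (joinStr_initSeg X f _)

theorem IsGenericFunction.not_computesSelector (hf : IsGenericFunction G f)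
    (hlen : ∀ n, ∃ p ∈ G, n ≤ p.str.length)
    (havoid : ∀ T, ∃ p ∈ G, p ∈ avoidsSelection Φ B A T) :
    ¬ComputesSelector (join (charFn B) f) A := by
  rintro ⟨h, hhA, hh⟩
  obtain ⟨T, hT⟩ :=
    TuringFunctional.exists_computes_of_recursiveIn (RecursiveIn.iff_nat.1 hh.recursiveIn)
  obtain ⟨q, hq, ⟨n, v, hv, hvA⟩ | ⟨n, hn⟩⟩ := havoid T
  · rw [hf.joinStr_str hq] at hv
    obtain rfl := Part.mem_some_iff.1 ((hT n v).2 ⟨_, hv⟩)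
    exact hvA (hhA n)
  · obtain ⟨s, hs⟩ := (hT.dom_iff n).1 trivial
    obtain ⟨p, hp, hsp⟩ := hlen s
    obtain ⟨r, hr, hrp, hrq⟩ := G.directed p hp q hq
    refine hn r hrq ?_
    rw [hf.joinStr_str hr]
    have hsr : s ≤ r.str.length := hsp.trans hrp.1.length_le
    exact T.mono_dom (initSeg_prefix _ (by omega)) hs

theorem forSufficientlyGeneric_not_computesSelector (hΦ : Φ.Standard)
    (hB : ¬ComputesSelector (charFn B) A) :
    ForSufficientlyGeneric fun G : Order.PFilter (Condition Φ B) =>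
      ∃ f, IsGenericFunction G f ∧ ¬ComputesSelector (join (charFn B) f) A := by
  refine ⟨Set.range (avoidsSelection Φ B A) ∪ Set.range fun n => {q | n ≤ q.str.length},
    (Set.countable_range _).union (Set.countable_range _), ?_, fun G hG => ?_⟩
  · rintro D (⟨T, rfl⟩ | ⟨n, rfl⟩)
    · exact isDense_avoidsSelection hΦ hB T
    · exact fun p => p.exists_le_length n
  have hlen (n : ℕ) : ∃ p ∈ G, n ≤ p.str.length := hG _ (Or.inr ⟨n, rfl⟩)
  obtain ⟨f, hf⟩ := exists_isGenericFunction hlen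
  exact ⟨f, hf, hf.not_computesSelector hlen fun T => hG _ (Or.inl ⟨T, rfl⟩)⟩

theorem ForSufficientlyGeneric.mono {P : Type} [Preorder P] {Q R : Order.PFilter P → Prop}
    (hQ : ForSufficientlyGeneric Q) (hQR : ∀ G, Q G → R G) : ForSufficientlyGeneric R := by
  obtain ⟨𝒟, hcountable, hdense, hmeets⟩ := hQ
  exact ⟨𝒟, hcountable, hdense, fun G hG => hQR G (hmeets G hG)⟩

end Generic

/-! ### DNR degrees and PA degrees -/

theorem hasDNRDegree_iff_computesSelector (X : ℕ → ℕ) : HasDNRDegree X ↔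
    ComputesSelector X fun e => {v | v ∉ (Denumerable.ofNat Nat.Partrec.Code e).eval e} :=
  Iff.rfl

theorem hasPADegree_iff_computesSelector (X : ℕ → ℕ) : HasPADegree X ↔
    ∀ ψ : ℕ →. Bool, Partrec ψ →
      ComputesSelector X fun n => encode '' {b : Bool | ∀ v ∈ ψ n, b = v} := by
  have hencode (h : ℕ → Bool) : ComputableIn (oracle X) (fun n => encode (h n)) ↔
      ComputableIn (oracle X) h := by
    simp [ComputableIn, RecursiveIn]
  refine forall₂_congr fun ψ _ => ⟨fun ⟨h, hψ, hh⟩ => ?_, fun ⟨h, hψ, hh⟩ => ?_⟩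
  · exact ⟨fun n => encode (h n), fun n => ⟨h n, hψ n, rfl⟩, (hencode h).2 hh⟩
  · choose b hb hbh using hψ
    obtain rfl : (fun n => encode (b n)) = h := funext hbh
    exact ⟨b, hb, (hencode b).1 hh⟩

end AEDomination

theorem mainTheorem6 (Φ : Functional) (hΦ : Φ.Standard) (B : ℕ → Bool) :
    -- the technical lemma
    (∀ p : Condition Φ B, ∃ S : Set (List ℕ), CEIn B S ∧
      (∀ g ∈ S, ∃ q ≤ p, q.str = g) ∧
      ∃ p' ≤ p, DenseBelow p' {q | q ≤ p' ∧ q.str ∈ S}) ∧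
    -- non-DNR degrees are preserved
    (¬ HasDNRDegree (charFn B) →
      ForSufficientlyGeneric fun G : Order.PFilter (Condition Φ B) =>
        ∃ f : ℕ → ℕ, IsGenericFunction G f ∧ ¬ HasDNRDegree (join (charFn B) f)) ∧
    -- non-PA degrees are preserved
    (¬ HasPADegree (charFn B) →
      ForSufficientlyGeneric fun G : Order.PFilter (Condition Φ B) =>
        ∃ f : ℕ → ℕ, IsGenericFunction G f ∧ ¬ HasPADegree (join (charFn B) f)) := by
  simp only [hasDNRDegree_iff_computesSelector, hasPADegree_iff_computesSelector]
  refine ⟨Condition.exists_ceIn_denseBelow hΦ, forSufficientlyGeneric_not_computesSelector hΦ,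
    fun hB => ?_⟩
  push Not at hB
  obtain ⟨ψ, hψ, hψB⟩ := hB
  refine (forSufficientlyGeneric_not_computesSelector hΦ hψB).mono fun G ⟨f, hf, hψf⟩ => ?_
  exact ⟨f, hf, fun hPA => hψf (hPA ψ hψ)⟩
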